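/- Let $G$ be a finite nilpotent group, and let $\chi$ be an irreducible complex character of $G$ with $\chi(1)>1$. Then $\chi(g)=0$ for more than half of the elements $g\in G$, that is, $|\{g\in G : \chi(g)=0\}| > |G|/2$. -/

import Mathlib

open scoped ComplexOrder

/-- `Irr G` is the set of (complex) irreducible characters of the group `G`: the functions
`G → ℂ` of the form `g ↦ trace (ρ g)` with `ρ` an irreducible representation of `G` on some `ℂⁿ`.
(Every finite-dimensional complex representation is isomorphic to one on some `ℂⁿ`, and
isomorphic representations have the same character. Irreducible representations are nonzero.) -/
def Irr (G : Type*) [Group G] : Set (G → ℂ) :=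
  {χ | ∃ (n : ℕ) (ρ : Representation ℂ G (Fin n → ℂ)), ρ.IsIrreducible ∧ ρ.character = χ}

/-! Nilpotency gives a `z` that acts by a non-scalar but is central modulo the elements acting by
scalars. If `ρ z` and `ρ g` do not commute, conjugating `g` by `z` multiplies `ρ g` by a scalar `c ≠
1`, so the character vanishes at `g`, and symmetrically at `z`. The `g` whose action commutes with
`ρ z` form a subgroup, proper by Schur, so its complement is at least half of `G`; `z` lies in the
subgroup and is one more zero, making the bound strict. -/

namespace Representation

open scoped commutatorElement

variable {k G V : Type*} [Field k] [AddCommGroup V] [Module k V]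

/-- Schur's lemma for a single operator: over an algebraically closed field, an endomorphism that
commutes with an irreducible finite-dimensional representation is a scalar. -/
theorem IsIrreducible.exists_eq_smul_one_of_commute [Monoid G] [IsAlgClosed k]
    [FiniteDimensional k V] {ρ : Representation k G V} (hρ : ρ.IsIrreducible)
    {f : Module.End k V} (hf : ∀ g, Commute f (ρ g)) : ∃ c : k, f = c • 1 := by
  let F : IntertwiningMap ρ ρ := ⟨f, fun g => hf g⟩
  obtain ⟨c, hc⟩ := (algebraMap_intertwiningMap_bijective_of_isAlgClosed (ρ := ρ)).2 F
  refine ⟨c, LinearMap.ext fun v => ?_⟩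
  exact (DFunLike.congr_fun hc v).symm

/-- An irreducible representation all of whose operators are scalars has dimension at most one. -/
theorem IsIrreducible.finrank_le_one_of_forall_eq_smul_one [Monoid G]
    {ρ : Representation k G V} (hρ : ρ.IsIrreducible) (h : ∀ g, ∃ c : k, ρ g = c • 1) :
    Module.finrank k V ≤ 1 := by
  by_cases hV : ∃ v : V, v ≠ 0
  · obtain ⟨v, hv⟩ := hV
    let W : Subrepresentation ρ := ⟨k ∙ v, fun g w hw => by
      obtain ⟨c, hc⟩ := h g
      simpa [hc] using Submodule.smul_mem _ c hw⟩
    have hvW : v ∈ W.toSubmodule := Submodule.mem_span_singleton_self v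
    rcases hρ.eq_bot_or_eq_top W with hW | hW
    · rw [hW] at hvW
      exact absurd ((Submodule.mem_bot k).1 hvW) hv
    · refine finrank_le_one v fun w => Submodule.mem_span_singleton.1 ?_
      change w ∈ W.toSubmodule
      rw [hW]
      exact Submodule.mem_top
  · push Not at hV
    have : Subsingleton V := subsingleton_of_forall_eq 0 hV
    simp [Module.finrank_zero_of_subsingleton]

variable [Group G] (ρ : Representation k G V)

/-- Take traces in `z * g * z⁻¹ = ⁅z, g⁆ * g` and `z = ⁅z, g⁆ * (g * z * g⁻¹)`. -/
theorem character_eq_smul_of_commutator {z g : G} {c : k} (h : ρ ⁅z, g⁆ = c • 1) :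
    ρ.character g = c * ρ.character g ∧ ρ.character z = c * ρ.character z := by
  constructor
  · have : ρ (z * g * z⁻¹) = c • ρ g := by
      rw [show z * g * z⁻¹ = ⁅z, g⁆ * g by simp [commutatorElement_def], map_mul, h, smul_mul_assoc,
        one_mul]
    calc ρ.character g = ρ.character (z * g * z⁻¹) := (ρ.char_conj g z).symm
      _ = c * ρ.character g := by simp [character, this]
  · have : ρ z = c • ρ (g * z * g⁻¹) := by
      rw [show ρ z = ρ (⁅z, g⁆ * (g * z * g⁻¹)) by
        congr 1; simp [commutatorElement_def, mul_assoc], map_mul, h, smul_mul_assoc, one_mul]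
    calc ρ.character z = c * ρ.character (g * z * g⁻¹) := by
          rw [character, this, map_smul, smul_eq_mul, character]
      _ = c * ρ.character z := by rw [ρ.char_conj z g]

/-- If `⁅z, g⁆` acts as a scalar and `ρ z` does not commute with `ρ g`, then the character vanishes
at both `g` and `z`. -/
theorem character_eq_zero_of_not_commute {z g : G} (h : ∃ c : k, ρ ⁅z, g⁆ = c • 1)
    (hzg : ¬ Commute (ρ z) (ρ g)) : ρ.character g = 0 ∧ ρ.character z = 0 := by
  obtain ⟨c, hc⟩ := h
  have hc1 : c ≠ 1 := by
    rintro rfl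
    refine hzg ?_
    rw [Commute, SemiconjBy, ← map_mul, ← map_mul,
      show z * g = ⁅z, g⁆ * (g * z) by simp [commutatorElement_def, mul_assoc], map_mul, hc,
      one_smul, one_mul]
  have key : ∀ x : k, x = c * x → x = 0 := fun x hx => by
    by_contra h0
    exact hc1 (mul_right_cancel₀ h0 (by rw [one_mul, ← hx]))
  obtain ⟨h₁, h₂⟩ := ρ.character_eq_smul_of_commutator hc
  exact ⟨key _ h₁, key _ h₂⟩

/-- The subgroup of elements whose action commutes with that of `z`. -/
def commutingSubgroup (z : G) : Subgroup G where
  carrier := {g | Commute (ρ z) (ρ g)}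
  one_mem' := by simp
  mul_mem' {a b} ha hb := by
    simpa only [Set.mem_ofPred_eq, map_mul] using Commute.mul_right ha hb
  inv_mem' {a} ha := by
    have h₁ : ρ a⁻¹ * ρ a = 1 := by rw [← map_mul, inv_mul_cancel, map_one]
    have h₂ : ρ a * ρ a⁻¹ = 1 := by rw [← map_mul, mul_inv_cancel, map_one]
    calc ρ z * ρ a⁻¹ = ρ a⁻¹ * (ρ a * ρ z) * ρ a⁻¹ := by rw [← mul_assoc, h₁, one_mul]
      _ = ρ a⁻¹ * (ρ z * ρ a) * ρ a⁻¹ := by rw [ha.eq]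
      _ = ρ a⁻¹ * ρ z := by rw [mul_assoc, mul_assoc, h₂, mul_one]

theorem mem_commutingSubgroup {z g : G} :
    g ∈ ρ.commutingSubgroup z ↔ Commute (ρ z) (ρ g) := Iff.rfl

/-- In a nilpotent group acting not only by scalars, some non-scalar element is central modulo the
elements acting by scalars. -/
theorem exists_not_scalar_forall_commutator_scalar [Group.IsNilpotent G]
    (h : ∃ g, ¬ ∃ c : k, ρ g = c • 1) :
    ∃ z, (¬ ∃ c : k, ρ z = c • 1) ∧ ∀ g, ∃ c : k, ρ ⁅z, g⁆ = c • 1 := by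
  classical
  obtain ⟨g, hg⟩ := h
  obtain ⟨m, hm⟩ := Group.IsNilpotent.nilpotent G
  have hex : ∃ n, ∃ z ∈ Subgroup.upperCentralSeries G n, ¬ ∃ c : k, ρ z = c • 1 :=
    ⟨m, g, hm ▸ Subgroup.mem_top g, hg⟩
  -- At the lowest term of the upper central series not acting by scalars, commutators with `z` fall
  -- one term lower, so they act by scalars.
  obtain ⟨z, hz, hzs⟩ := Nat.find_spec hex
  rcases hn : Nat.find hex with _ | n
  · rw [hn, Subgroup.upperCentralSeries_zero, Subgroup.mem_bot] at hz
    exact absurd ⟨1, by rw [hz, map_one, one_smul]⟩ hzs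
  · rw [hn, Subgroup.mem_upperCentralSeries_succ_iff] at hz
    refine ⟨z, hzs, fun y => ?_⟩
    by_contra hy
    exact Nat.find_min hex (m := n) (by omega) ⟨_, hz y, hy⟩

end Representation

/-- A set that contains the complement of a proper subgroup and meets that subgroup contains more
than half of the elements of the group. -/
theorem Subgroup.card_lt_two_mul_card_of_compl_subset {G : Type*} [Group G] [Finite G]
    {H : Subgroup G} (hH : H ≠ ⊤) {S : Set G} (hS : ∀ g ∉ H, g ∈ S) {z : G} (hzH : z ∈ H)
    (hzS : z ∈ S) : Nat.card G < 2 * Nat.card S := by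
  have hidx : 2 ≤ H.index := H.one_lt_index_of_ne_top hH
  have hcard : Nat.card H * 2 ≤ Nat.card G :=
    H.card_mul_index ▸ Nat.mul_le_mul_left _ hidx
  have hsub : insert z (H : Set G)ᶜ ⊆ S := Set.insert_subset hzS hS
  have hle := Set.ncard_le_ncard hsub
  rw [Set.ncard_insert_of_notMem (by simpa using hzH)] at hle
  have hadd := Set.ncard_add_ncard_compl (H : Set G)
  have hHn : (H : Set G).ncard = Nat.card H := rfl
  have hSn : S.ncard = Nat.card S := rfl
  omega

theorem theorem1 (G : Type*) [Group G] [Finite G] (hG : Group.IsNilpotent G)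
    (χ : G → ℂ) (hχ : χ ∈ Irr G) (hdeg : 1 < χ 1) :
    (Nat.card G : ℝ) / 2 < (Nat.card {g : G // χ g = 0} : ℝ) := by
  obtain ⟨n, ρ, hρ, rfl⟩ := hχ
  have hn : 1 < Module.finrank ℂ (Fin n → ℂ) := by
    rw [Representation.char_one] at hdeg
    exact_mod_cast hdeg
  have hns : ∃ g, ¬ ∃ c : ℂ, ρ g = c • 1 := by
    by_contra! h
    exact absurd (hρ.finrank_le_one_of_forall_eq_smul_one h) (by omega)
  obtain ⟨z, hz, hcomm⟩ := ρ.exists_not_scalar_forall_commutator_scalar hns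
  have hvanish : ∀ g ∉ ρ.commutingSubgroup z, ρ.character g = 0 ∧ ρ.character z = 0 :=
    fun g hg => ρ.character_eq_zero_of_not_commute (hcomm g) hg
  have hne : ρ.commutingSubgroup z ≠ ⊤ := fun htop =>
    hz (hρ.exists_eq_smul_one_of_commute fun g =>
      ρ.mem_commutingSubgroup.1 (htop ▸ Subgroup.mem_top g))
  -- One such `g` is needed to know that the character vanishes at `z`.
  obtain ⟨g, hg⟩ : ∃ g, g ∉ ρ.commutingSubgroup z := by
    by_contra! h
    exact hne (eq_top_iff.2 fun g _ => h g)
  have hlt : Nat.card G < 2 * Nat.card {g : G // ρ.character g = 0} :=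
    Subgroup.card_lt_two_mul_card_of_compl_subset (S := {g | ρ.character g = 0}) hne
      (fun g hg => (hvanish g hg).1) (ρ.mem_commutingSubgroup.2 (Commute.refl _)) (hvanish g hg).2
  have hlt' : (Nat.card G : ℝ) < 2 * (Nat.card {g : G // ρ.character g = 0} : ℝ) := by
    exact_mod_cast hlt
  linarith
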